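/- There exist a numerical constant $c>0$ and, for every integer $n\ge 1$, a constant $c_n>0$ depending only on $n$, such that the following holds. Let $w$ be a strong Muckenhoupt weight on $\mathbb{R}^n$, i.e. a non-negative locally integrable function $w$ with $[w]_{A_\infty^*}<\infty$, where $$[w]_{A_\infty^*}:=\sup_{1\le j\le n}\ \operatorname*{ess\,sup}_{\bar x^j\in\mathbb{R}^{n-1}}\ [w_{\bar x^j}]_{A_\infty},\qquad \bar x^j:=(x_1,\dots,x_{j-1},x_{j+1},\dots,x_n),\quad w_{\bar x^j}(t):=w(x_1,\dots,x_{j-1},t,x_{j+1},\dots,x_n)\quad(t\in\mathbb{R}),$$ and, for a weight $v$ on the real line, $$[v]_{A_\infty}:=\sup_I \frac{1}{v(I)}\int_I M(v\mathbf 1_I)(x)\,dx,\qquad Mf(x):=\sup_{J\ni x}\frac1{|J|}\int_J|f|,$$ the suprema being over bounded intervals $I,J\subset\mathbb{R}$ of positive length (with the quotient read as $0$ when $v(I)=0$). Write $w(E):=\int_E w(x)\,dx$. Then for every bounded rectangular parallelepiped $R\subset\mathbb{R}^n$ with sides of positive length parallel to the coordinate axes, and every Lebesgue measurable set $E\subseteq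 R$, $$w(E)\le c_n\Big(\frac{|E|}{|R|}\Big)^{1/(c\,n\,[w]_{A_\infty^*})}\,w(R),$$ that is, $\dfrac{w(E)}{w(R)}\le c_n\Big(\dfrac{|E|}{|R|}\Big)^{1/(cn[w]_{A_\infty^*})}$ whenever $w(R)>0$. (If $w=0$ almost everywhere, so that $[w]_{A_\infty^*}=0$, both sides of the first inequality are read as $0$.) -/

import Mathlib

open MeasureTheory Set
open scoped ENNReal

noncomputable section

/-- The non-centered Hardy-Littlewood maximal function on the real line, with values in `[0, ∞]`:
the supremum of the averages of `|f|` over the bounded intervals containing `x`. -/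
def maximalFunction (f : ℝ → ℝ) (x : ℝ) : ℝ≥0∞ :=
  ⨆ (a : ℝ) (b : ℝ) (_ : a < x ∧ x < b),
    (∫⁻ y in Ioo a b, ENNReal.ofReal |f y|) / ENNReal.ofReal (b - a)

/-- The Fujii-Wilson constant of a weight `w` on the real line, with values in `[0, ∞]`:
the supremum over all bounded intervals `I` of `w(I)⁻¹ ∫_I M(w 1_I)`.
When `w(I) = 0` the quotient is `0 / 0 = 0`. -/
def ainftyConst (w : ℝ → ℝ) : ℝ≥0∞ :=
  ⨆ (a : ℝ) (b : ℝ) (_ : a < b),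
    (∫⁻ x in Ioo a b, maximalFunction ((Ioo a b).indicator w) x) /
      (∫⁻ x in Ioo a b, ENNReal.ofReal (w x))

/-- The one-dimensional slice of `w` in the `j`-th coordinate direction, the other coordinates
being given by `y`. -/
def slice {n : ℕ} (w : (Fin n → ℝ) → ℝ) (j : Fin n) (y : {i : Fin n // i ≠ j} → ℝ) (t : ℝ) : ℝ :=
  w (fun i => if h : i = j then t else y ⟨i, h⟩)

/-- The strong `A_∞` constant of a weight on `ℝⁿ`, with values in `[0, ∞]`: the supremum over the
coordinate directions `j`, and the essential supremum over the remaining `n - 1` coordinates, of the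
Fujii-Wilson constants of the slices. -/
def strongAinftyConst {n : ℕ} (w : (Fin n → ℝ) → ℝ) : ℝ≥0∞ :=
  ⨆ j : Fin n, essSup (fun y : {i : Fin n // i ≠ j} → ℝ => ainftyConst (slice w j y)) volume

/-- A weight: a non-negative locally integrable function on `ℝⁿ`. -/
structure IsWeight {n : ℕ} (w : (Fin n → ℝ) → ℝ) : Prop where
  nonneg : ∀ x, 0 ≤ w x
  locallyIntegrable : LocallyIntegrable w volume

/-- The strong Muckenhoupt class `A_∞^*`: weights with finite strong `A_∞` constant. -/
structure IsStrongAinfty {n : ℕ} (w : (Fin n → ℝ) → ℝ) : Prop where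
  isWeight : IsWeight w
  const_lt_top : strongAinftyConst w < ∞

/-- The closed axis-parallel rectangle with opposite vertices `a` and `b`. -/
def rectangle {n : ℕ} (a b : Fin n → ℝ) : Set (Fin n → ℝ) :=
  {x | ∀ i, a i ≤ x i ∧ x i ≤ b i}

end

/-! The heart is the case of the line, with measure `ν = v dx` and Fujii-Wilson constant at most
`A`. Let `T` be a finite union of dyadic subintervals of `I` of small density, and let `T'` be the
union of the maximal dyadic intervals `Q` in which `T` has density above 1/4. By maximality `T`
fills at most half of `Q`, and on the rest of `Q` the maximal function is at least the mean
`ν(Q)/|Q|`. So the integral of `M(v 1_I)` grows by at least `ν(T')/2` from `T` to `T'`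
(`measure_toSet_add_half_le`). Summing `N` such gains inside each finally selected interval, and
bounding the result there by the Fujii-Wilson condition, shows that `N` thickenings multiply `ν(T)`
by at least `N/(2A)` (`nsmul_measure_toSet_le_mul`). Take `N` about `4A`: `ν` at least doubles while
length grows by a factor at most `4^N`. Iterating gives decay with exponent of order `1/N`, hence
`1/A`, and open sets carry the bound from dyadic unions to arbitrary sets.

In higher dimension, induct by slicing (`setLIntegral_le_of_slices`). Lines meeting `E` in
proportion less than `l` contribute at most `C l^δ` of the mass. The other lines have a base of
proportion at most `m/l`, where `m = |E|/|R|`, and the inductive bound applies to that base.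
Balancing the two with `l = m^(1/(n+1))` divides the one-dimensional exponent by the dimension and
nothing more. -/

/-! ### Finite dyadic unions and their thickening -/

/-- A finite binary tree, encoding a finite union of dyadic subintervals of an interval. -/
inductive DyadicTree : Type
  | empty : DyadicTree
  | full : DyadicTree
  | node : DyadicTree → DyadicTree → DyadicTree

namespace DyadicTree

/-- The subset of `(a, b]` encoded by a tree. -/
def toSet : DyadicTree → ℝ → ℝ → Set ℝ
  | empty, _, _ => ∅
  | full, a, b => Ioc a b
  | node l r, a, b => l.toSet a ((a + b) / 2) ∪ r.toSet ((a + b) / 2) b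

/-- The proportion of `(a, b]` that is covered by the set encoded by a tree. -/
noncomputable def density : DyadicTree → ℝ
  | empty => 0
  | full => 1
  | node l r => (l.density + r.density) / 2

open Classical in
/-- The union of the maximal nodes of a tree in which its density exceeds `1 / 4`. -/
noncomputable def thicken : DyadicTree → DyadicTree
  | empty => empty
  | full => full
  | node l r => if 1 / 4 < (node l r).density then full else node l.thicken r.thicken

theorem toSet_subset (T : DyadicTree) {a b : ℝ} (h : a ≤ b) : T.toSet a b ⊆ Ioc a b := by
  induction T generalizing a b with
  | empty => simp [toSet]
  | full => simp [toSet]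
  | node l r hl hr =>
    refine union_subset ((hl (by linarith)).trans ?_) ((hr (by linarith)).trans ?_)
    · exact Ioc_subset_Ioc le_rfl (by linarith)
    · exact Ioc_subset_Ioc (by linarith) le_rfl

theorem measurableSet_toSet (T : DyadicTree) (a b : ℝ) : MeasurableSet (T.toSet a b) := by
  induction T generalizing a b with
  | empty => simp [toSet]
  | full => simp [toSet]
  | node l r hl hr => exact (hl _ _).union (hr _ _)

theorem measure_node (μ : Measure ℝ) (l r : DyadicTree) {a b : ℝ} (h : a ≤ b) :
    μ ((node l r).toSet a b) =
      μ (l.toSet a ((a + b) / 2)) + μ (r.toSet ((a + b) / 2) b) := by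
  refine measure_union ?_ (measurableSet_toSet _ _ _)
  exact (Ioc_disjoint_Ioc_of_le le_rfl).mono (toSet_subset l (by linarith))
    (toSet_subset r (by linarith))

theorem measure_Ioc_midpoint (μ : Measure ℝ) {a b : ℝ} (h : a ≤ b) :
    μ (Ioc a b) = μ (Ioc a ((a + b) / 2)) + μ (Ioc ((a + b) / 2) b) := by
  rw [← measure_union (Ioc_disjoint_Ioc_of_le le_rfl) measurableSet_Ioc,
    Ioc_union_Ioc_eq_Ioc (by linarith) (by linarith)]

theorem density_nonneg (T : DyadicTree) : 0 ≤ T.density := by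
  induction T with
  | empty => simp [density]
  | full => simp [density]
  | node l r hl hr => simp only [density]; linarith

theorem density_le_one (T : DyadicTree) : T.density ≤ 1 := by
  induction T with
  | empty => simp [density]
  | full => simp [density]
  | node l r hl hr => simp only [density]; linarith

theorem volume_toSet (T : DyadicTree) {a b : ℝ} (h : a ≤ b) :
    volume (T.toSet a b) = ENNReal.ofReal (T.density * (b - a)) := by
  induction T generalizing a b with
  | empty => simp [toSet, density]
  | full => simp [toSet, density]
  | node l r hl hr =>
    rw [measure_node _ _ _ h, hl (by linarith), hr (by linarith), ← ENNReal.ofReal_add]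
    · congr 1
      simp only [density]
      ring
    · exact mul_nonneg (density_nonneg l) (by linarith)
    · exact mul_nonneg (density_nonneg r) (by linarith)

theorem thicken_of_density_gt {T : DyadicTree} (h : 1 / 4 < T.density) : T.thicken = full := by
  cases T with
  | empty => norm_num [density] at h
  | full => rfl
  | node l r => rw [thicken, if_pos h]

theorem thicken_node_of_density_le {l r : DyadicTree} (h : (node l r).density ≤ 1 / 4) :
    (node l r).thicken = node l.thicken r.thicken := by
  rw [thicken, if_neg (not_lt.2 h)]

theorem density_le_density_thicken (T : DyadicTree) : T.density ≤ T.thicken.density := by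
  induction T with
  | empty => simp [thicken]
  | full => simp [thicken]
  | node l r hl hr =>
    rcases lt_or_ge (1 / 4) (node l r).density with h | h
    · rw [thicken_of_density_gt h]
      exact density_le_one _
    · rw [thicken_node_of_density_le h]
      simp only [density]
      linarith

/-- The selected intervals are disjoint, contain the whole set, and each is filled to more than a
quarter. -/
theorem density_thicken_le (T : DyadicTree) : T.thicken.density ≤ 4 * T.density := by
  induction T with
  | empty => simp [thicken, density]
  | full => norm_num [thicken, density]
  | node l r hl hr =>
    rcases lt_or_ge (1 / 4) (node l r).density with h | h
    · rw [thicken_of_density_gt h]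
      change (1 : ℝ) ≤ _
      linarith
    · rw [thicken_node_of_density_le h]
      simp only [density]
      linarith

theorem density_iterate_thicken_le (T : DyadicTree) (k : ℕ) :
    (thicken^[k] T).density ≤ 4 ^ k * T.density := by
  induction k with
  | zero => simp
  | succ k ih =>
    rw [Function.iterate_succ_apply', pow_succ]
    linarith [density_thicken_le (thicken^[k] T)]

theorem density_iterate_thicken_mono (T : DyadicTree) :
    Monotone fun k => (thicken^[k] T).density := by
  refine monotone_nat_of_le_succ fun k => ?_
  rw [Function.iterate_succ_apply']
  exact density_le_density_thicken _

theorem toSet_subset_toSet_thicken (T : DyadicTree) {a b : ℝ} (h : a ≤ b) :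
    T.toSet a b ⊆ T.thicken.toSet a b := by
  induction T generalizing a b with
  | empty => simp [thicken]
  | full => simp [thicken]
  | node l r hl hr =>
    rcases lt_or_ge (1 / 4) (node l r).density with h' | h'
    · rw [thicken_of_density_gt h']
      exact toSet_subset _ h
    · rw [thicken_node_of_density_le h']
      exact union_subset_union (hl (by linarith)) (hr (by linarith))

theorem toSet_subset_toSet_iterate_thicken (T : DyadicTree) {a b : ℝ} (h : a ≤ b) (k : ℕ) :
    T.toSet a b ⊆ (thicken^[k] T).toSet a b := by
  induction k with
  | zero => exact subset_rfl
  | succ k ih =>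
    rw [Function.iterate_succ_apply']
    exact ih.trans (toSet_subset_toSet_thicken _ h)

/-- Densities only increase under thickening, so a node still below the threshold at stage `k` was
never selected earlier, and all thickenings so far acted on its two halves separately. -/
theorem iterate_thicken_node {l r : DyadicTree} {k : ℕ}
    (h : (thicken^[k] (node l r)).density ≤ 1 / 4) :
    thicken^[k + 1] (node l r) = node (thicken^[k + 1] l) (thicken^[k + 1] r) ∧
      thicken^[k] (node l r) = node (thicken^[k] l) (thicken^[k] r) := by
  induction k with
  | zero => exact ⟨thicken_node_of_density_le h, rfl⟩
  | succ k ih =>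
    have h1 := (ih ((density_iterate_thicken_mono _ k.le_succ).trans h)).1
    refine ⟨?_, h1⟩
    rw [h1] at h
    rw [Function.iterate_succ_apply', h1, thicken_node_of_density_le h,
      Function.iterate_succ_apply' _ (k + 1) l, Function.iterate_succ_apply' _ (k + 1) r]

theorem iterate_thicken_full (k : ℕ) : thicken^[k] full = full :=
  Function.iterate_fixed rfl k

/-! ### Dyadic exhaustion of open sets -/

/-- The tree of depth `m` encoding the dyadic subintervals of `(a, b]` contained in `U`. -/
noncomputable def inner (U : Set ℝ) : ℕ → ℝ → ℝ → DyadicTree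
  | 0, a, b => open Classical in if Ioc a b ⊆ U then full else empty
  | m + 1, a, b => node (inner U m a ((a + b) / 2)) (inner U m ((a + b) / 2) b)

theorem toSet_inner_subset (U : Set ℝ) (m : ℕ) (a b : ℝ) : (inner U m a b).toSet a b ⊆ U := by
  induction m generalizing a b with
  | zero =>
    rw [inner]
    split_ifs with h
    · exact h
    · exact empty_subset _
  | succ m ih => exact union_subset (ih _ _) (ih _ _)

theorem toSet_inner_of_subset {U : Set ℝ} (m : ℕ) {a b : ℝ} (hab : a ≤ b) (h : Ioc a b ⊆ U) :
    (inner U m a b).toSet a b = Ioc a b := by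
  induction m generalizing a b with
  | zero => rw [inner, if_pos h, toSet]
  | succ m ih =>
    rw [inner, toSet, ih (by linarith) ((Ioc_subset_Ioc le_rfl (by linarith)).trans h),
      ih (by linarith) ((Ioc_subset_Ioc (by linarith) le_rfl).trans h),
      Ioc_union_Ioc_eq_Ioc (by linarith) (by linarith)]

theorem monotone_toSet_inner (U : Set ℝ) {a b : ℝ} (hab : a ≤ b) :
    Monotone fun m => (inner U m a b).toSet a b := by
  refine monotone_nat_of_le_succ fun m => ?_
  induction m generalizing a b with
  | zero =>
    by_cases h : Ioc a b ⊆ U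
    · rw [toSet_inner_of_subset _ hab h, toSet_inner_of_subset _ hab h]
    · rw [inner, if_neg h]
      exact empty_subset _
  | succ m ih => exact union_subset_union (ih (by linarith)) (ih (by linarith))

theorem mem_toSet_inner {U : Set ℝ} {x ε : ℝ} (hU : Metric.ball x ε ⊆ U) (m : ℕ) {a b : ℝ}
    (hx : x ∈ Ioc a b) (hm : b - a < 2 ^ m * ε) : x ∈ (inner U m a b).toSet a b := by
  induction m generalizing a b with
  | zero =>
    rw [toSet_inner_of_subset _ (hx.1.le.trans hx.2)]
    · exact hx
    · refine fun y hy => hU ?_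
      rw [Metric.mem_ball, Real.dist_eq, abs_lt]
      constructor <;> linarith [hx.1, hx.2, hy.1, hy.2]
  | succ m ih =>
    rw [pow_succ] at hm
    rcases le_or_gt x ((a + b) / 2) with h | h
    · exact Or.inl (ih ⟨hx.1, h⟩ (by linarith))
    · exact Or.inr (ih ⟨h, hx.2⟩ (by linarith))

theorem iUnion_toSet_inner {U : Set ℝ} (hU : IsOpen U) {a b : ℝ} (hab : a ≤ b) :
    ⋃ m, (inner U m a b).toSet a b = U ∩ Ioc a b := by
  refine subset_antisymm
    (iUnion_subset fun m => subset_inter (toSet_inner_subset _ _ _ _) (toSet_subset _ hab)) ?_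
  rintro x ⟨hxU, hx⟩
  obtain ⟨ε, hε, hball⟩ := Metric.isOpen_iff.1 hU x hxU
  obtain ⟨m, hm⟩ := pow_unbounded_of_one_lt ((b - a) / ε) one_lt_two
  exact mem_iUnion.2 ⟨m, mem_toSet_inner hball m hx ((div_lt_iff₀ hε).1 hm)⟩

end DyadicTree

/-! ### Growth of mass under thickening -/

/-- The measure `μ` has, on each subinterval of `(a, b]`, density at least the mean of `ν` over that
subinterval. -/
def DominatesMeans (μ ν : Measure ℝ) (a b : ℝ) : Prop :=
  ∀ x y, a ≤ x → x < y → y ≤ b → ∀ x' y', x ≤ x' → x' < y' → y' ≤ y →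
    ν (Ioc x y) / ENNReal.ofReal (y - x) * ENNReal.ofReal (y' - x') ≤ μ (Ioc x' y')

theorem DominatesMeans.mono {μ ν : Measure ℝ} {a b x y : ℝ} (h : DominatesMeans μ ν a b)
    (hx : a ≤ x) (hy : y ≤ b) : DominatesMeans μ ν x y :=
  fun u v hu huv hv => h u v (hx.trans hu) huv (hv.trans hy)

namespace DyadicTree

/-- The gaps left by the tree are disjoint dyadic intervals of total length `(1 - T.density) * (b -
a)`, and `μ` has mean density at least `c` on each. -/
theorem measure_toSet_add_le {μ : Measure ℝ} {c : ℝ≥0∞} (T : DyadicTree) {a b : ℝ} (hab : a < b)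
    (h : ∀ x y, a ≤ x → x < y → y ≤ b → c * ENNReal.ofReal (y - x) ≤ μ (Ioc x y)) :
    μ (T.toSet a b) + c * ENNReal.ofReal ((1 - T.density) * (b - a)) ≤ μ (Ioc a b) := by
  induction T generalizing a b with
  | empty => simpa [toSet, density] using h a b le_rfl hab le_rfl
  | full => simp [toSet, density]
  | node l r hl hr =>
    rw [measure_node _ _ _ hab.le, measure_Ioc_midpoint _ hab.le]
    have e : (1 - (node l r).density) * (b - a) =
        (1 - l.density) * ((a + b) / 2 - a) + (1 - r.density) * (b - (a + b) / 2) := by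
      simp only [density]
      ring
    rw [e, ENNReal.ofReal_add
      (mul_nonneg (sub_nonneg.2 l.density_le_one) (by linarith))
      (mul_nonneg (sub_nonneg.2 r.density_le_one) (by linarith)), mul_add, add_add_add_comm]
    exact add_le_add (hl (by linarith) fun x y hx hxy hy => h x y hx hxy (by linarith))
      (hr (by linarith) fun x y hx hxy hy => h x y (by linarith) hxy hy)

/-- Each selected interval `Q` is at least half empty, and `μ` has density at least the `ν`-mean of
`Q` on the empty part. The thresholds 1/4 and 1/2 match: a half of a node of density at most 1/4 has
density at most 1/2. -/
theorem measure_toSet_add_half_le {μ ν : Measure ℝ} (T : DyadicTree) {a b : ℝ} (hab : a < b)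
    (h : DominatesMeans μ ν a b) (hT : T.density ≤ 1 / 2) :
    μ (T.toSet a b) + 2⁻¹ * ν (T.thicken.toSet a b) ≤ μ (T.thicken.toSet a b) := by
  induction T generalizing a b with
  | empty => simp [toSet, thicken]
  | full => norm_num [density] at hT
  | node l r hl hr =>
    rcases lt_or_ge (1 / 4) (node l r).density with h' | h'
    · rw [thicken_of_density_gt h']
      refine le_trans ?_ (measure_toSet_add_le (node l r) hab (h a b le_rfl hab le_rfl))
      refine add_le_add le_rfl ?_
      change 2⁻¹ * ν (Ioc a b) ≤ _
      have hb : ENNReal.ofReal (b - a) ≠ 0 := by simpa using hab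
      calc 2⁻¹ * ν (Ioc a b)
          = ν (Ioc a b) / ENNReal.ofReal (b - a) * (2⁻¹ * ENNReal.ofReal (b - a)) := by
            rw [mul_left_comm, ENNReal.div_mul_cancel hb ENNReal.ofReal_ne_top]
        _ = ν (Ioc a b) / ENNReal.ofReal (b - a) * ENNReal.ofReal (1 / 2 * (b - a)) := by
            rw [ENNReal.ofReal_mul (by norm_num), one_div,
              ENNReal.ofReal_inv_of_pos (by norm_num), ENNReal.ofReal_ofNat]
        _ ≤ _ := by
            gcongr
            linarith
    · rw [thicken_node_of_density_le h', measure_node _ _ _ hab.le, measure_node _ _ _ hab.le,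
        measure_node _ _ _ hab.le, mul_add, add_add_add_comm]
      simp only [density] at h'
      have := l.density_nonneg
      have := r.density_nonneg
      exact add_le_add
        (hl (by linarith) (h.mono le_rfl (by linarith)) (by linarith))
        (hr (by linarith) (h.mono (by linarith) le_rfl) (by linarith))

/-- Telescoping: each of the `k` thickenings gains at least half the `ν`-mass of a set containing
the original one. -/
theorem nsmul_measure_toSet_le {μ ν : Measure ℝ} (T : DyadicTree) {a b : ℝ} (hab : a < b)
    (h : DominatesMeans μ ν a b) (k : ℕ) (hT : ∀ i < k, (thicken^[i] T).density ≤ 1 / 2) :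
    k * (2⁻¹ * ν (T.toSet a b)) ≤ μ ((thicken^[k] T).toSet a b) := by
  induction k with
  | zero => simp
  | succ k ih =>
    have h1 := measure_toSet_add_half_le (thicken^[k] T) hab h (hT k k.lt_succ_self)
    rw [← Function.iterate_succ_apply' thicken] at h1
    refine le_trans ?_ h1
    push_cast
    rw [add_mul, one_mul]
    gcongr
    · exact ih fun i hi => hT i (hi.trans k.lt_succ_self)
    · exact toSet_subset_toSet_iterate_thicken _ hab.le _

/-- If `ν` satisfies a Fujii-Wilson condition, a set loses a fixed proportion of its `ν`-measure
against the set obtained by iterating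
`thicken` on it. -/
theorem nsmul_measure_toSet_le_mul {ν : Measure ℝ} {A : ℝ≥0∞} {a₀ b₀ : ℝ}
    (H : ∀ a b, a₀ ≤ a → a < b → b ≤ b₀ →
      ∃ μ : Measure ℝ, DominatesMeans μ ν a b ∧ μ (Ioc a b) ≤ A * ν (Ioc a b))
    (k : ℕ) (T : DyadicTree) {a b : ℝ} (ha : a₀ ≤ a) (hab : a < b) (hb : b ≤ b₀)
    (hT : (thicken^[k] T).density ≤ 1 / 2) :
    (k + 1 : ℕ) * (2⁻¹ * ν (T.toSet a b)) ≤ A * ν ((thicken^[k + 1] T).toSet a b) := by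
  induction T generalizing a b with
  | empty => simp [toSet]
  | full =>
    rw [iterate_thicken_full] at hT
    norm_num [density] at hT
  | node l r hl hr =>
    rcases lt_or_ge (1 / 4) (thicken^[k] (node l r)).density with h' | h'
    -- This interval is filled at stage `k + 1`. Its density stayed at most 1/2 until then, so all
    -- `k + 1` gains occur inside it, for the `μ` attached to this very interval.
    · obtain ⟨μ, hμ, hμA⟩ := H a b ha hab hb
      have h1 := nsmul_measure_toSet_le (node l r) hab hμ (k + 1) fun i hi =>
        (density_iterate_thicken_mono _ (Nat.lt_succ_iff.1 hi)).trans hT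
      rw [Function.iterate_succ_apply', thicken_of_density_gt h'] at h1 ⊢
      exact h1.trans hμA
    · obtain ⟨e1, e2⟩ := iterate_thicken_node h'
      rw [e2] at h'
      simp only [density] at h'
      have := (thicken^[k] l).density_nonneg
      have := (thicken^[k] r).density_nonneg
      rw [e1, measure_node _ _ _ hab.le, measure_node _ _ _ hab.le, mul_add, mul_add, mul_add]
      exact add_le_add (hl ha (by linarith) (by linarith) (by linarith))
        (hr (by linarith) (by linarith) hb (by linarith))

/-- A block of `N` thickenings at least doubles `ν` and multiplies the density by at most `4 ^ N`.
The hypothesis leaves room for `j` such blocks. -/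
theorem two_pow_mul_measure_toSet_le {ν : Measure ℝ} {A : ℝ≥0∞} (hA₀ : A ≠ 0) (hA : A ≠ ∞)
    {a b : ℝ} (hab : a < b)
    (H : ∀ x y, a ≤ x → x < y → y ≤ b →
      ∃ μ : Measure ℝ, DominatesMeans μ ν x y ∧ μ (Ioc x y) ≤ A * ν (Ioc x y))
    {N : ℕ} (hN₀ : N ≠ 0) (hN : 4 * A ≤ N) (j : ℕ) (T : DyadicTree)
    (hT : (4 ^ N) ^ j * (2 * T.density) ≤ 1) :
    2 ^ j * ν (T.toSet a b) ≤ ν (Ioc a b) := by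
  induction j generalizing T with
  | zero => simpa using measure_mono (toSet_subset T hab.le)
  | succ j ih =>
    obtain ⟨k, rfl⟩ : ∃ k, N = k + 1 := Nat.exists_eq_succ_of_ne_zero hN₀
    have hd := T.density_nonneg
    have h1 : (1 : ℝ) ≤ (4 ^ (k + 1)) ^ j := one_le_pow₀ (one_le_pow₀ (by norm_num))
    have h2 : (4 : ℝ) ^ (k + 1) = 4 * 4 ^ k := pow_succ' _ _
    have h3 : 4 ^ (k + 1) * (2 * T.density) ≤ 1 := by
      refine le_trans ?_ hT
      rw [pow_succ _ j, mul_assoc]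
      exact le_mul_of_one_le_left (by positivity) h1
    have h4 : (thicken^[k] T).density ≤ 1 / 2 := by
      have := density_iterate_thicken_le T k
      have : 0 ≤ 4 ^ k * T.density := by positivity
      rw [h2] at h3
      linarith
    have h5 := nsmul_measure_toSet_le_mul H k T le_rfl hab le_rfl h4
    have h6 : 2 * ν (T.toSet a b) ≤ ν ((thicken^[k + 1] T).toSet a b) := by
      rw [← ENNReal.mul_le_mul_iff_right hA₀ hA]
      refine le_trans ?_ h5
      calc A * (2 * ν (T.toSet a b)) = 4 * A * (2⁻¹ * ν (T.toSet a b)) := by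
            have : (4 : ℝ≥0∞) * 2⁻¹ = 2 := by
              rw [show (4 : ℝ≥0∞) = 2 * 2 by norm_num, mul_assoc,
                ENNReal.mul_inv_cancel two_ne_zero ENNReal.ofNat_ne_top, mul_one]
            rw [mul_mul_mul_comm, this, mul_left_comm]
        _ ≤ _ := by gcongr
    have h7 := ih (thicken^[k + 1] T) (by
      refine le_trans ?_ hT
      rw [pow_succ _ j, mul_assoc]
      refine mul_le_mul_of_nonneg_left ?_ (by positivity)
      linarith [density_iterate_thicken_le T (k + 1)])
    rw [pow_succ, mul_assoc]
    exact le_trans (by gcongr) h7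

theorem measure_toSet_le_rpow {ν : Measure ℝ} {A : ℝ≥0∞} (hA₀ : A ≠ 0) (hA : A ≠ ∞)
    {a b : ℝ} (hab : a < b)
    (H : ∀ x y, a ≤ x → x < y → y ≤ b →
      ∃ μ : Measure ℝ, DominatesMeans μ ν x y ∧ μ (Ioc x y) ≤ A * ν (Ioc x y))
    {N : ℕ} (hN₀ : N ≠ 0) (hN : 4 * A ≤ N) {δ : ℝ} (hδ₀ : 0 ≤ δ) (hδ : 2 * N * δ ≤ 1)
    (T : DyadicTree) {e : ℝ} (he : 0 < e) (hT : T.density ≤ e) :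
    ν (T.toSet a b) ≤ ENNReal.ofReal (4 * e ^ δ) * ν (Ioc a b) := by
  have hN1 : (1 : ℝ) ≤ N := by exact_mod_cast Nat.one_le_iff_ne_zero.2 hN₀
  have hδ1 : δ ≤ 1 := by nlinarith
  have h2δ : (2 : ℝ) ^ δ ≤ 2 := by
    simpa using Real.rpow_le_rpow_of_exponent_le one_le_two hδ1
  have h2e : (2 * e) ^ δ ≤ 2 * e ^ δ := by
    rw [Real.mul_rpow zero_le_two he.le]
    gcongr
  -- `j` is the largest number of doublings available, that is `(4^N)^j ≤ 1/(2e) < (4^N)^(j+1)`. One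
  -- factor 2 of the constant 4 pays for the passage from `j + 1` to `j`, the other for `2^δ ≤ 2`.
  -- If `2e > 1`, no doubling is needed.
  obtain ⟨j, hj, hj'⟩ : ∃ j : ℕ, 2 ^ j * ν (T.toSet a b) ≤ ν (Ioc a b) ∧
      (1 : ℝ) ≤ 2 ^ j * (4 * e ^ δ) := by
    rcases le_or_gt (2 * e) 1 with h | h
    · obtain ⟨j, hj, hj'⟩ := exists_nat_pow_near (one_le_one_div (by positivity) h)
        (one_lt_pow₀ (by norm_num : (1 : ℝ) < 4) hN₀)
      rw [le_div_iff₀ (by positivity)] at hj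
      rw [div_lt_iff₀ (by positivity)] at hj'
      refine ⟨j, two_pow_mul_measure_toSet_le hA₀ hA hab H hN₀ hN j T (le_trans ?_ hj), ?_⟩
      · gcongr
      have hL : (((4 : ℝ) ^ N) ^ (j + 1)) ^ δ ≤ 2 ^ (j + 1) := by
        rw [← Real.rpow_natCast (_ ^ N), ← Real.rpow_mul (by positivity), mul_comm _ δ,
          Real.rpow_mul (by positivity), Real.rpow_natCast]
        gcongr
        rw [← Real.rpow_natCast 4, ← Real.rpow_mul (by norm_num), show (4 : ℝ) = 2 ^ (2 : ℝ) by
          norm_num, ← Real.rpow_mul (by norm_num)]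
        calc (2 : ℝ) ^ (2 * (N * δ)) ≤ 2 ^ (1 : ℝ) :=
              Real.rpow_le_rpow_of_exponent_le one_le_two (by linarith)
          _ = 2 := by norm_num
      calc (1 : ℝ) ≤ (((4 : ℝ) ^ N) ^ (j + 1) * (2 * e)) ^ δ := Real.one_le_rpow hj'.le hδ₀
        _ = (((4 : ℝ) ^ N) ^ (j + 1)) ^ δ * (2 * e) ^ δ :=
            Real.mul_rpow (by positivity) (by positivity)
        _ ≤ 2 ^ (j + 1) * (2 * e ^ δ) := by gcongr
        _ = 2 ^ j * (4 * e ^ δ) := by ring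
    · refine ⟨0, by simpa using measure_mono (toSet_subset T hab.le), ?_⟩
      have := Real.one_le_rpow h.le hδ₀
      linarith
  have hj'' : 1 ≤ 2 ^ j * ENNReal.ofReal (4 * e ^ δ) := by
    have := ENNReal.ofReal_le_ofReal hj'
    rwa [ENNReal.ofReal_one, ENNReal.ofReal_mul (by positivity), ENNReal.ofReal_pow zero_le_two,
      ENNReal.ofReal_ofNat] at this
  calc ν (T.toSet a b) ≤ 2 ^ j * ENNReal.ofReal (4 * e ^ δ) * ν (T.toSet a b) :=
        le_mul_of_one_le_left zero_le hj''
    _ = ENNReal.ofReal (4 * e ^ δ) * (2 ^ j * ν (T.toSet a b)) := by ring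
    _ ≤ _ := by gcongr

end DyadicTree

open DyadicTree in
theorem measure_le_rpow_mul_measure_Ioc {ν : Measure ℝ} {A : ℝ≥0∞} (hA₀ : A ≠ 0) (hA : A ≠ ∞)
    {a b : ℝ} (hab : a < b)
    (H : ∀ x y, a ≤ x → x < y → y ≤ b →
      ∃ μ : Measure ℝ, DominatesMeans μ ν x y ∧ μ (Ioc x y) ≤ A * ν (Ioc x y))
    {N : ℕ} (hN₀ : N ≠ 0) (hN : 4 * A ≤ N) {δ : ℝ} (hδ₀ : 0 ≤ δ) (hδ : 2 * N * δ ≤ 1)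
    (hν : ν (Ioc a b) ≠ ∞) {E : Set ℝ} (hE : E ⊆ Ioc a b) :
    ν E ≤ 4 * (volume E / ENNReal.ofReal (b - a)) ^ δ * ν (Ioc a b) := by
  have hba : 0 < b - a := sub_pos.2 hab
  have hb : ENNReal.ofReal (b - a) ≠ 0 := by simpa using hab
  set x : ℝ≥0∞ := volume E / ENNReal.ofReal (b - a) with hx
  have hEtop : volume E ≠ ∞ := ((measure_mono hE).trans_lt measure_Ioc_lt_top).ne
  have hxtop : x ≠ ∞ := ENNReal.div_ne_top hEtop hb
  have key : ∀ e : ℝ, x.toReal < e → ν E ≤ ENNReal.ofReal (4 * e ^ δ) * ν (Ioc a b) := by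
    intro e he
    have he0 : 0 < e := ENNReal.toReal_nonneg.trans_lt he
    have hlt : volume E < ENNReal.ofReal (e * (b - a)) := by
      rw [ENNReal.ofReal_mul he0.le, ← ENNReal.div_lt_iff (Or.inl hb)
        (Or.inl ENNReal.ofReal_ne_top), ← hx]
      exact (ENNReal.lt_ofReal_iff_toReal_lt hxtop).2 he
    obtain ⟨U, hEU, hU, hUv⟩ := Set.exists_isOpen_lt_of_lt E _ hlt
    calc ν E ≤ ν (⋃ m, (inner U m a b).toSet a b) := by
          rw [iUnion_toSet_inner hU hab.le]
          exact measure_mono (subset_inter hEU hE)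
      _ = ⨆ m, ν ((inner U m a b).toSet a b) := (monotone_toSet_inner U hab.le).measure_iUnion
      _ ≤ _ := iSup_le fun m => by
          refine measure_toSet_le_rpow hA₀ hA hab H hN₀ hN hδ₀ hδ _ he0 ?_
          have h1 := (measure_mono (μ := volume) (toSet_inner_subset U m a b)).trans hUv.le
          rw [volume_toSet _ hab.le, ENNReal.ofReal_le_ofReal_iff (by positivity)] at h1
          exact le_of_mul_le_mul_right h1 hba
  have e1 : 4 * x ^ δ = ENNReal.ofReal (4 * x.toReal ^ δ) := by
    rw [ENNReal.ofReal_mul (by norm_num), ENNReal.ofReal_ofNat,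
      ← ENNReal.ofReal_rpow_of_nonneg ENNReal.toReal_nonneg hδ₀, ENNReal.ofReal_toReal hxtop]
  rw [e1]
  -- The bound holds for every `e` above the proportion of `E`; let `e` decrease to it.
  have hc : Filter.Tendsto (fun e : ℝ => ENNReal.ofReal (4 * e ^ δ) * ν (Ioc a b))
      (nhdsWithin x.toReal (Ioi x.toReal))
      (nhds (ENNReal.ofReal (4 * x.toReal ^ δ) * ν (Ioc a b))) := by
    refine ENNReal.Tendsto.mul_const ?_ (Or.inr hν)
    refine Filter.Tendsto.mono_left ?_ nhdsWithin_le_nhds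
    exact (ENNReal.continuous_ofReal.comp
      (continuous_const.mul (Real.continuous_rpow_const hδ₀))).tendsto _
  exact ge_of_tendsto hc (eventually_nhdsWithin_of_forall key)

/-! ### The one-dimensional estimate from the Fujii-Wilson condition -/

/-- The quantitative absolute continuity, with constant `C` and exponent `δ`, of the measure with
density `f` on the real line. -/
def HasAinftyEstimate (C : ℝ≥0∞) (δ : ℝ) (f : ℝ → ℝ≥0∞) : Prop :=
  ∀ a b : ℝ, a < b → ∀ E : Set ℝ, MeasurableSet E → E ⊆ Icc a b →
    ∫⁻ x in E, f x ≤ C * (volume E / ENNReal.ofReal (b - a)) ^ δ * ∫⁻ x in Icc a b, f x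

theorem setLIntegral_Ioo_eq_Ioc (f : ℝ → ℝ≥0∞) (a b : ℝ) :
    ∫⁻ x in Ioo a b, f x = ∫⁻ x in Ioc a b, f x :=
  setLIntegral_congr Ioo_ae_eq_Ioc

theorem ofReal_abs_indicator {v : ℝ → ℝ} (hv : ∀ t, 0 ≤ v t) (s : Set ℝ) (x : ℝ) :
    ENNReal.ofReal |s.indicator v x| = s.indicator (fun t => ENNReal.ofReal (v t)) x := by
  by_cases h : x ∈ s <;> simp [h, abs_of_nonneg (hv x)]

theorem setLIntegral_maximalFunction_le {v : ℝ → ℝ} (hv : ∀ t, 0 ≤ v t) {A : ℝ≥0∞} (hA₀ : A ≠ 0)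
    (hA : ainftyConst v ≤ A) {a b : ℝ} (hab : a < b) :
    ∫⁻ x in Ioo a b, maximalFunction ((Ioo a b).indicator v) x ≤
      A * ∫⁻ x in Ioo a b, ENNReal.ofReal (v x) := by
  rcases eq_or_ne (∫⁻ x in Ioo a b, ENNReal.ofReal (v x)) 0 with h0 | h0
  · have hM : ∀ x, maximalFunction ((Ioo a b).indicator v) x = 0 := by
      intro x
      simp only [maximalFunction, ENNReal.iSup_eq_zero]
      intro c d _
      rw [ENNReal.div_eq_zero_iff]
      left
      refine le_antisymm (le_trans (setLIntegral_le_lintegral _ _) ?_) zero_le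
      simp only [ofReal_abs_indicator hv]
      rw [lintegral_indicator measurableSet_Ioo, h0]
    simp [hM]
  -- Division by `∞` gives 0, so the Fujii-Wilson quotient says nothing here; `A ≠ 0` makes the
  -- right side infinite.
  rcases eq_or_ne (∫⁻ x in Ioo a b, ENNReal.ofReal (v x)) ∞ with h1 | h1
  · rw [h1, ENNReal.mul_top hA₀]
    exact le_top
  rw [← ENNReal.div_le_iff h0 h1]
  refine le_trans ?_ hA
  exact le_iSup₂_of_le a b (le_iSup_of_le hab le_rfl)

/-- The interval over which the mean is taken is itself a competitor in the supremum defining the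
maximal function at each of its points. -/
theorem dominatesMeans_maximalFunction {v : ℝ → ℝ} (hv : ∀ t, 0 ≤ v t) (a b : ℝ) :
    DominatesMeans (volume.withDensity (maximalFunction ((Ioo a b).indicator v)))
      (volume.withDensity fun x => ENNReal.ofReal (v x)) a b := by
  intro x y hx hxy hy x' y' hx' hxy' hy'
  rw [withDensity_apply _ measurableSet_Ioc, withDensity_apply _ measurableSet_Ioc,
    ← setLIntegral_Ioo_eq_Ioc, ← setLIntegral_Ioo_eq_Ioc, ← Real.volume_Ioo,
    ← Real.volume_Ioo (a := x'), ← setLIntegral_const]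
  refine setLIntegral_mono' measurableSet_Ioo fun t ht => ?_
  refine le_trans (le_of_eq ?_) (le_iSup₂_of_le x y
    (le_iSup_of_le ⟨hx'.trans_lt ht.1, ht.2.trans_le hy'⟩ le_rfl))
  rw [Real.volume_Ioo]
  congr 1
  refine setLIntegral_congr_fun measurableSet_Ioo fun s hs => ?_
  have : s ∈ Ioo a b := ⟨hx.trans_lt hs.1, hs.2.trans_le hy⟩
  change _ = ENNReal.ofReal |_|
  rw [ofReal_abs_indicator hv, indicator_of_mem this]

/-- A weight on the line with Fujii-Wilson constant at most `A` satisfies an `A_∞` estimate whose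
exponent is comparable to `1 / A`. -/
theorem hasAinftyEstimate_of_ainftyConst_le {v : ℝ → ℝ} (hv : ∀ t, 0 ≤ v t) {A : ℝ} (hA₀ : 0 < A)
    (hA : ainftyConst v ≤ ENNReal.ofReal A) :
    HasAinftyEstimate 4 (1 / (10 * A)) fun x => ENNReal.ofReal (v x) := by
  intro a b hab E hE hEI
  have hA₀' : ENNReal.ofReal A ≠ 0 := by simpa using hA₀
  have hb : ENNReal.ofReal (b - a) ≠ 0 := by simpa using hab
  set ν : Measure ℝ := volume.withDensity fun x => ENNReal.ofReal (v x) with hν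
  have hac : ν ≪ volume := withDensity_absolutelyContinuous _ _
  have hIcc : ν (Icc a b) = ν (Ioc a b) := measure_congr (hac.ae_eq Ioc_ae_eq_Icc.symm)
  rw [← withDensity_apply _ hE, ← withDensity_apply _ measurableSet_Icc, ← hν, hIcc]
  have H : ∀ x y, a ≤ x → x < y → y ≤ b → ∃ μ : Measure ℝ,
      DominatesMeans μ ν x y ∧ μ (Ioc x y) ≤ ENNReal.ofReal A * ν (Ioc x y) := by
    intro x y _ hxy _
    refine ⟨_, dominatesMeans_maximalFunction hv x y, ?_⟩
    rw [withDensity_apply _ measurableSet_Ioc, withDensity_apply _ measurableSet_Ioc,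
      ← setLIntegral_Ioo_eq_Ioc, ← setLIntegral_Ioo_eq_Ioc]
    exact setLIntegral_maximalFunction_le hv hA₀' hA hxy
  rcases eq_or_ne (ν (Ioc a b)) 0 with h0 | h0
  · exact (measure_mono hEI).trans (by simp [hIcc, h0])
  rcases eq_or_ne (ν (Ioc a b)) ∞ with h1 | h1
  · rcases eq_or_ne (volume E) 0 with hE0 | hE0
    · rw [hac hE0]
      exact zero_le
    · rw [h1, ENNReal.mul_top]
      · exact le_top
      · refine mul_ne_zero (by norm_num) ?_
        have h2 : volume E / ENNReal.ofReal (b - a) ≠ 0 :=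
          (ENNReal.div_pos hE0 ENNReal.ofReal_ne_top).ne'
        have : 0 ≤ 1 / (10 * A) := by positivity
        rw [Ne, ENNReal.rpow_eq_zero_iff, not_or]
        exact ⟨fun h => h2 h.1, fun h => not_lt.2 this h.2⟩
  -- The maximal function is at least the mean over the whole interval. With `A ≥ 1`, `N = ⌈4A⌉ ≤
  -- 5A`, whence the exponent `1 / (10 * A)`.
  have hA1 : 1 ≤ A := by
    obtain ⟨μ, hμ, hμA⟩ := H a b le_rfl hab le_rfl
    have h2 := (hμ a b le_rfl hab le_rfl a b le_rfl hab le_rfl).trans hμA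
    rw [ENNReal.div_mul_cancel hb ENNReal.ofReal_ne_top] at h2
    have h3 : 1 * ν (Ioc a b) ≤ ENNReal.ofReal A * ν (Ioc a b) := by rwa [one_mul]
    rw [ENNReal.mul_le_mul_iff_left h0 h1] at h3
    simpa using h3
  have hN : (⌈4 * A⌉₊ : ℝ) < 4 * A + 1 := Nat.ceil_lt_add_one (by positivity)
  have hE' : ν E ≤ ν (E ∩ Ioc a b) := by
    have hs : E ⊆ E ∩ Ioc a b ∪ {a} := fun x hx =>
      (hEI hx).1.eq_or_lt.elim (fun h => Or.inr h.symm) fun h => Or.inl ⟨hx, h, (hEI hx).2⟩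
    refine ((measure_mono hs).trans (measure_union_le _ _)).trans_eq ?_
    rw [hac (measure_singleton a), add_zero]
  refine hE'.trans ((measure_le_rpow_mul_measure_Ioc hA₀' ENNReal.ofReal_ne_top hab H
    (N := ⌈4 * A⌉₊) (δ := 1 / (10 * A)) ?_ ?_ (by positivity) ?_ h1 inter_subset_right).trans ?_)
  · exact (Nat.ceil_pos.2 (by positivity)).ne'
  · rw [← ENNReal.ofReal_natCast, ← ENNReal.ofReal_ofNat, ← ENNReal.ofReal_mul (by norm_num)]
    exact ENNReal.ofReal_le_ofReal (Nat.le_ceil _)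
  · rw [mul_one_div, div_le_one (by positivity)]
    linarith
  · gcongr
    exact inter_subset_left

/-! ### Slicing and induction on the dimension -/

/-- Combining an estimate in the first variable with one in the second, by splitting the second
variable according to whether the section of `E` has proportion at least `l`. -/
theorem setLIntegral_le_of_slices {Y : Type*} [MeasureSpace Y] [SFinite (volume : Measure Y)]
    {G : ℝ × Y → ℝ≥0∞} (hG : AEMeasurable G) {C K : ℝ≥0∞} (hC : C ≠ ∞) (hK : K ≠ ∞) {δ s : ℝ}
    (hδ : 0 ≤ δ) (hs : 0 ≤ s) {a b : ℝ} (hab : a < b) {R : Set Y} (hR : MeasurableSet R)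
    (h₁ : ∀ᵐ y, HasAinftyEstimate C δ fun t => G (t, y))
    (h₂ : ∀ᵐ t, ∀ F, MeasurableSet F → F ⊆ R →
      ∫⁻ y in F, G (t, y) ≤ K * (volume F / volume R) ^ s * ∫⁻ y in R, G (t, y))
    {E : Set (ℝ × Y)} (hE : MeasurableSet E) (hER : E ⊆ Icc a b ×ˢ R)
    {l : ℝ≥0∞} (hl₀ : l ≠ 0) (hl : l ≠ ∞) :
    ∫⁻ z in E, G z ≤
      C * (l ^ δ + K * (volume E / (volume R * ENNReal.ofReal (b - a)) / l) ^ s) *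
        ∫⁻ z in Icc a b ×ˢ R, G z := by
  have hb : ENNReal.ofReal (b - a) ≠ 0 := by simpa using hab
  set L := ENNReal.ofReal (b - a) with hL
  have hLtop : L ≠ ∞ := ENNReal.ofReal_ne_top
  set S : Y → Set ℝ := fun y => (fun t => (t, y)) ⁻¹' E
  have hSm : ∀ y, MeasurableSet (S y) := fun y => measurable_prodMk_right hE
  have hSsub : ∀ y, S y ⊆ Icc a b := fun y t ht => (hER ht).1
  have hSv : Measurable fun y => volume (S y) := measurable_measure_prodMk_right hE
  set F : Set Y := R ∩ {y | l * L ≤ volume (S y)}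
  have hFm : MeasurableSet F := hR.inter (measurableSet_le measurable_const hSv)
  set W : Y → ℝ≥0∞ := fun y => ∫⁻ t in Icc a b, G (t, y)
  have hsw : ∀ B : Set Y, ∫⁻ y in B, W y = ∫⁻ z in Icc a b ×ˢ B, G z := fun B =>
    (setLIntegral_prod_symm _ hG.restrict).symm
  have e1 : ∫⁻ z in E, G z = ∫⁻ y, ∫⁻ t in S y, G (t, y) := by
    rw [← lintegral_indicator hE, Measure.volume_eq_prod,
      lintegral_prod_symm _ (hG.indicator hE)]
    refine lintegral_congr fun y => ?_
    rw [← lintegral_indicator (hSm y)]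
    rfl
  have e2 : ∫⁻ y, ∫⁻ t in S y, G (t, y) = ∫⁻ y in R, ∫⁻ t in S y, G (t, y) := by
    rw [← lintegral_indicator hR]
    refine lintegral_congr fun y => ?_
    by_cases hy : y ∈ R
    · rw [indicator_of_mem hy]
    · have : S y = ∅ := eq_empty_of_forall_notMem fun t ht => hy (hER ht).2
      rw [indicator_of_notMem hy, this]
      simp
  have b1 : ∫⁻ y in R ∩ F, ∫⁻ t in S y, G (t, y) ≤ C * ∫⁻ y in F, W y := by
    rw [inter_eq_right.2 inter_subset_left, ← lintegral_const_mul' _ _ hC]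
    refine lintegral_mono_ae (ae_restrict_of_ae (h₁.mono fun y hy => ?_))
    refine (hy a b hab (S y) (hSm y) (hSsub y)).trans ?_
    gcongr
    refine mul_le_of_le_one_right zero_le (ENNReal.rpow_le_one ?_ hδ)
    refine ENNReal.div_le_of_le_mul ?_
    rw [one_mul, ← Real.volume_Icc]
    exact measure_mono (hSsub y)
  have b2 : ∫⁻ y in R \ F, ∫⁻ t in S y, G (t, y) ≤ C * l ^ δ * ∫⁻ y in R, W y := by
    rw [← lintegral_const_mul' _ _ (ENNReal.mul_ne_top hC (ENNReal.rpow_ne_top_of_nonneg hδ hl))]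
    refine le_trans ?_ (lintegral_mono_set (s := R \ F) sdiff_subset)
    refine setLIntegral_mono_ae' (hR.diff hFm) (h₁.mono fun y hy hyF => ?_)
    refine (hy a b hab (S y) (hSm y) (hSsub y)).trans ?_
    gcongr
    refine ENNReal.div_le_of_le_mul (le_of_lt (not_le.1 fun h => hyF.2 ⟨hyF.1, h⟩))
  -- Fubini in the other order: for almost every `t`, the estimate in the second variable applies to
  -- the same set `F`.
  have b3 : ∫⁻ y in F, W y ≤
      K * (volume F / volume R) ^ s * ∫⁻ z in Icc a b ×ˢ R, G z := by
    have hFR : volume F / volume R ≤ 1 :=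
      ENNReal.div_le_of_le_mul (by rw [one_mul]; exact measure_mono inter_subset_left)
    have hκ : K * (volume F / volume R) ^ s ≠ ∞ :=
      ENNReal.mul_ne_top hK ((ENNReal.rpow_le_one hFR hs).trans_lt ENNReal.one_lt_top).ne
    rw [hsw, Measure.volume_eq_prod, setLIntegral_prod _ hG.restrict,
      setLIntegral_prod _ hG.restrict, ← lintegral_const_mul' _ _ hκ]
    exact lintegral_mono_ae (ae_restrict_of_ae (h₂.mono fun t ht => ht F hFm inter_subset_left))
  -- Chebyshev's inequality for the lengths of the sections.
  have b4 : volume F / volume R ≤ volume E / (volume R * L) / l := by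
    have h3 : l * L * volume F ≤ volume E := by
      rw [Measure.volume_eq_prod, Measure.prod_apply_symm hE]
      exact (mul_le_mul_right (measure_mono inter_subset_right) _).trans
        (mul_meas_ge_le_lintegral hSv _)
    have h4 : volume F ≤ volume E / (l * L) := by
      rw [ENNReal.le_div_iff_mul_le (Or.inl (mul_ne_zero hl₀ hb))
        (Or.inl (ENNReal.mul_ne_top hl hLtop)), mul_comm]
      exact h3
    refine (ENNReal.div_le_div_right h4 _).trans_eq ?_
    simp only [div_eq_mul_inv]
    rw [ENNReal.mul_inv (Or.inl hl₀) (Or.inl hl), ENNReal.mul_inv (Or.inr hLtop) (Or.inr hb)]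
    ring
  rw [e1, e2, ← lintegral_inter_add_sdiff _ R hFm, mul_add, add_comm (C * l ^ δ), add_mul]
  refine add_le_add (b1.trans ?_) (b2.trans_eq (by rw [hsw]))
  rw [mul_assoc C]
  gcongr
  refine b3.trans ?_
  gcongr

/-- Prepending a coordinate to a vector, as a measurable equivalence. -/
def measurableEquivFinCons (n : ℕ) : ℝ × (Fin n → ℝ) ≃ᵐ (Fin (n + 1) → ℝ) :=
  (MeasurableEquiv.piFinSuccAbove (fun _ => ℝ) 0).symm

theorem measurableEquivFinCons_apply {n : ℕ} (t : ℝ) (x : Fin n → ℝ) :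
    measurableEquivFinCons n (t, x) = Fin.cons t x :=
  Fin.insertNth_zero' t x

theorem measurePreserving_measurableEquivFinCons (n : ℕ) :
    MeasurePreserving (measurableEquivFinCons n) :=
  (volume_preserving_piFinSuccAbove (fun _ : Fin (n + 1) => ℝ) 0).symm

theorem preimage_measurableEquivFinCons_Icc {n : ℕ} (a b : Fin (n + 1) → ℝ) :
    measurableEquivFinCons n ⁻¹' Icc a b = Icc (a 0) (b 0) ×ˢ Icc (Fin.tail a) (Fin.tail b) := by
  ext ⟨t, x⟩
  simp only [mem_preimage, measurableEquivFinCons_apply, mem_prod, mem_Icc, Pi.le_def,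
    Fin.forall_fin_succ, Fin.cons_zero, Fin.cons_succ, Fin.tail]
  tauto

theorem ae_ae_update_zero {n : ℕ} {p : (ℝ → (Fin (n + 1) → ℝ)) → Prop}
    (h : ∀ᵐ x : Fin (n + 1) → ℝ, p fun t => Function.update x 0 t) :
    ∀ᵐ x : Fin n → ℝ, p fun t => Fin.cons t x := by
  have h1 := (measurePreserving_measurableEquivFinCons n).quasiMeasurePreserving.ae h
  have h2 := (Measure.measurePreserving_swap (μ := (volume : Measure (Fin n → ℝ)))
    (ν := (volume : Measure ℝ))).quasiMeasurePreserving.ae h1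
  refine (Measure.ae_ae_of_ae_prod h2).mono fun x hx => ?_
  -- The value `s` is overwritten by the update, so a single good `s` suffices.
  obtain ⟨s, hs⟩ := hx.exists
  simpa [measurableEquivFinCons_apply] using hs

theorem ae_ae_update_succ {n : ℕ} {j : Fin n} {p : (ℝ → (Fin (n + 1) → ℝ)) → Prop}
    (h : ∀ᵐ x : Fin (n + 1) → ℝ, p fun t => Function.update x j.succ t) :
    ∀ᵐ s : ℝ, ∀ᵐ x : Fin n → ℝ, p fun t => Fin.cons s (Function.update x j t) := by
  have h1 := (measurePreserving_measurableEquivFinCons n).quasiMeasurePreserving.ae h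
  refine (Measure.ae_ae_of_ae_prod h1).mono fun s hs => hs.mono fun x hx => ?_
  simpa [measurableEquivFinCons_apply, Fin.cons_update] using hx

/-- One-dimensional `A_∞` estimates in all coordinate directions give an `A_∞` estimate on
rectangles, the exponent being divided by the dimension. -/
theorem exists_rectangle_estimate (C : ℝ≥0∞) (hC : C ≠ ∞) (n : ℕ) (hn : 1 ≤ n) :
    ∃ K : ℝ≥0∞, K ≠ ∞ ∧ ∀ δ : ℝ, 0 ≤ δ → ∀ g : (Fin n → ℝ) → ℝ≥0∞, AEMeasurable g →
      (∀ j, ∀ᵐ x, HasAinftyEstimate C δ fun t => g (Function.update x j t)) →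
      ∀ a b : Fin n → ℝ, (∀ i, a i < b i) → ∀ E, MeasurableSet E → E ⊆ Icc a b →
        ∫⁻ x in E, g x ≤ K * (volume E / volume (Icc a b)) ^ (δ / n) * ∫⁻ x in Icc a b, g x := by
  induction n, hn using Nat.le_induction with
  | base =>
    refine ⟨C, hC, fun δ hδ g hg h a b hab E hE hEI => ?_⟩
    obtain ⟨x, hx⟩ := (h 0).exists
    set e : ℝ ≃ᵐ (Fin 1 → ℝ) := (MeasurableEquiv.funUnique (Fin 1) ℝ).symm with he
    have hp : MeasurePreserving e := (volume_preserving_funUnique (Fin 1) ℝ).symm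
    have hup : ∀ t, Function.update x 0 t = e t := by
      intro t
      ext i
      rw [Subsingleton.elim i 0, Function.update_self]
      rfl
    simp only [hup] at hx
    have hI : e ⁻¹' Icc a b = Icc (a 0) (b 0) := by
      ext t
      simp only [mem_preimage, mem_Icc, Pi.le_def, Fin.forall_fin_one]
      rfl
    have hvI : volume (Icc a b) = ENNReal.ofReal (b 0 - a 0) := by
      rw [← hp.measure_preimage_equiv, hI, Real.volume_Icc]
    rw [← hp.setLIntegral_comp_preimage_emb e.measurableEmbedding,
      ← hp.setLIntegral_comp_preimage_emb e.measurableEmbedding, hI, hvI,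
      ← hp.measure_preimage_equiv E, Nat.cast_one, div_one]
    exact hx _ _ (hab 0) _ (e.measurable hE) (hI ▸ preimage_mono hEI)
  | succ n hn ih =>
    obtain ⟨K, hK, ih⟩ := ih
    refine ⟨C * (1 + K), ENNReal.mul_ne_top hC (by simpa using hK),
      fun δ hδ g hg h a b hab E hE hEI => ?_⟩
    set e := measurableEquivFinCons n
    have hp : MeasurePreserving e := measurePreserving_measurableEquivFinCons n
    set R : Set (Fin n → ℝ) := Icc (Fin.tail a) (Fin.tail b) with hR
    have hI : e ⁻¹' Icc a b = Icc (a 0) (b 0) ×ˢ R := preimage_measurableEquivFinCons_Icc a b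
    have hvI : volume (Icc a b) = volume R * ENNReal.ofReal (b 0 - a 0) := by
      rw [← hp.measure_preimage_equiv, hI, Measure.volume_eq_prod, Measure.prod_prod,
        Real.volume_Icc, mul_comm]
    have hG : AEMeasurable fun z => g (e z) := hg.comp_quasiMeasurePreserving
      hp.quasiMeasurePreserving
    have h₁ : ∀ᵐ x : Fin n → ℝ, HasAinftyEstimate C δ fun t => g (e (t, x)) := by
      simp only [e, measurableEquivFinCons_apply]
      exact ae_ae_update_zero (p := fun φ => HasAinftyEstimate C δ fun t => g (φ t)) (h 0)
    have h₂ : ∀ᵐ t : ℝ, ∀ F, MeasurableSet F → F ⊆ R →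
        ∫⁻ y in F, g (e (t, y)) ≤
          K * (volume F / volume R) ^ (δ / n) * ∫⁻ y in R, g (e (t, y)) := by
      have h3 : ∀ᵐ t : ℝ, ∀ j : Fin n, ∀ᵐ x : Fin n → ℝ,
          HasAinftyEstimate C δ fun s => g (Fin.cons t (Function.update x j s)) :=
        ae_all_iff.2 fun j => ae_ae_update_succ
          (p := fun φ => HasAinftyEstimate C δ fun t => g (φ t)) (h j.succ)
      have h4 : ∀ᵐ t : ℝ, AEMeasurable fun x => g (e (t, x)) := by
        obtain ⟨G', hG'm, hG'⟩ := hG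
        exact (Measure.ae_ae_of_ae_prod hG').mono fun t ht =>
          ⟨fun x => G' (t, x), hG'm.comp measurable_prodMk_left, ht⟩
      filter_upwards [h3, h4] with t ht htm F hF hFR
      exact ih δ hδ (fun x => g (e (t, x))) htm
        (by simpa only [e, measurableEquivFinCons_apply] using ht) _ _
        (fun i => hab i.succ) F hF hFR
    set m := volume E / volume (Icc a b) with hm
    have hm1 : m ≤ 1 := ENNReal.div_le_of_le_mul (by rw [one_mul]; exact measure_mono hEI)
    rcases eq_or_ne (volume E) 0 with hE0 | hE0
    · rw [setLIntegral_measure_zero _ _ hE0]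
      exact zero_le
    have hItop : volume (Icc a b) ≠ ∞ := isCompact_Icc.measure_lt_top.ne
    have hm0 : m ≠ 0 := (ENNReal.div_pos hE0 hItop).ne'
    have hmtop : m ≠ ∞ := (hm1.trans_lt ENNReal.one_lt_top).ne
    -- This `l` balances the two terms: `l^δ` and `(m/l)^(δ/n)` both equal `m^(δ/(n+1))`.
    have key := setLIntegral_le_of_slices hG hC hK hδ (by positivity : 0 ≤ δ / n) (hab 0)
      measurableSet_Icc h₁ h₂ (e.measurable hE) (hI ▸ preimage_mono hEI)
      (l := m ^ (1 / ((n : ℝ) + 1))) (by simp [ENNReal.rpow_eq_zero_iff, hm0, hmtop])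
      (ENNReal.rpow_ne_top_of_nonneg (by positivity) hmtop)
    rw [← hI, hp.setLIntegral_comp_preimage_emb e.measurableEmbedding,
      hp.setLIntegral_comp_preimage_emb e.measurableEmbedding, hp.measure_preimage_equiv,
      ← hvI, ← hm] at key
    have hn0 : (n : ℝ) ≠ 0 := by exact_mod_cast (Nat.one_le_iff_ne_zero.1 hn)
    have hn1 : (n : ℝ) + 1 ≠ 0 := by positivity
    have e1 : (m ^ (1 / ((n : ℝ) + 1))) ^ δ = m ^ (δ / (n + 1 : ℕ)) := by
      rw [← ENNReal.rpow_mul]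
      congr 1
      push_cast
      ring
    have e2 : (m / m ^ (1 / ((n : ℝ) + 1))) ^ (δ / n) = m ^ (δ / (n + 1 : ℕ)) := by
      have : m / m ^ (1 / ((n : ℝ) + 1)) = m ^ (1 - 1 / ((n : ℝ) + 1)) := by
        rw [ENNReal.rpow_sub _ _ hm0 hmtop, ENNReal.rpow_one]
      rw [this, ← ENNReal.rpow_mul]
      congr 1
      push_cast
      field_simp
      ring
    rw [e1, e2] at key
    refine key.trans_eq ?_
    ring

/-! ### From the strong constant to the theorem -/

theorem ae_hasAinftyEstimate_update {n : ℕ} {w : (Fin n → ℝ) → ℝ} (hw : ∀ x, 0 ≤ w x) {A : ℝ}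
    (hA₀ : 0 < A) (hA : strongAinftyConst w ≤ ENNReal.ofReal A) (j : Fin n) :
    ∀ᵐ x, HasAinftyEstimate 4 (1 / (10 * A)) fun t =>
      ENNReal.ofReal (w (Function.update x j t)) := by
  have h1 : ∀ᵐ y : {i : Fin n // i ≠ j} → ℝ, ainftyConst (slice w j y) ≤ ENNReal.ofReal A :=
    (ENNReal.ae_le_essSup _).mono fun y hy => (hy.trans (le_iSup (fun j : Fin n =>
      essSup (fun y : {i : Fin n // i ≠ j} → ℝ => ainftyConst (slice w j y)) volume) j)).trans hA
  have hq := Measure.quasiMeasurePreserving_fst.comp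
    (volume_preserving_piEquivPiSubtypeProd (fun _ : Fin n => ℝ)
      (fun i => i ≠ j)).quasiMeasurePreserving
  filter_upwards [hq.ae h1] with x hx
  have := hasAinftyEstimate_of_ainftyConst_le (fun t => hw _) hA₀ hx
  convert this using 4 with t
  ext i
  by_cases h : i = j
  · subst h
    simp
  · simp [h, MeasurableEquiv.piEquivPiSubtypeProd, Equiv.piEquivPiSubtypeProd]

theorem rectangle_eq_Icc {n : ℕ} (a b : Fin n → ℝ) : rectangle a b = Icc a b := by
  ext x
  simp only [rectangle, mem_ofPred_eq, mem_Icc, Pi.le_def, forall_and]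

theorem mainTheorem6 :
    ∃ c : ℝ, 0 < c ∧ ∀ n : ℕ, 1 ≤ n → ∃ Cn : ℝ, 0 < Cn ∧
      ∀ w : (Fin n → ℝ) → ℝ, IsStrongAinfty w →
        ∀ a b : Fin n → ℝ, (∀ i, a i < b i) →
          ∀ E : Set (Fin n → ℝ), NullMeasurableSet E volume → E ⊆ rectangle a b →
            (∫ x in E, w x) ≤
              Cn * (volume.real E / volume.real (rectangle a b)) ^
                  (1 / (c * (n : ℝ) * (strongAinftyConst w).toReal)) *
                ∫ x in rectangle a b, w x := by
  refine ⟨10, by norm_num, fun n hn => ?_⟩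
  obtain ⟨K, hK, hmain⟩ := exists_rectangle_estimate 4 (by norm_num) n hn
  refine ⟨K.toReal + 1, by positivity, fun w hw a b hab E hE hER => ?_⟩
  rw [rectangle_eq_Icc] at hER ⊢
  have hw0 := hw.isWeight.nonneg
  have hwm : AEStronglyMeasurable w volume := hw.isWeight.locallyIntegrable.aestronglyMeasurable
  have hint : IntegrableOn w (Icc a b) :=
    hw.isWeight.locallyIntegrable.integrableOn_isCompact isCompact_Icc
  have hI0 : 0 ≤ ∫ x in Icc a b, w x := integral_nonneg hw0
  have hmono : ∫ x in E, w x ≤ ∫ x in Icc a b, w x :=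
    setIntegral_mono_set hint (Filter.Eventually.of_forall hw0) hER.eventuallyLE
  set A := (strongAinftyConst w).toReal with hA
  have hA_nonneg : 0 ≤ A := ENNReal.toReal_nonneg
  -- If the constant is 0, the exponent `1 / 0` is 0 and the power is 1, so monotonicity and a
  -- constant at least 1 suffice; hence the `+ 1` in the choice of `Cn`.
  rcases hA_nonneg.eq_or_lt with hA0 | hA0
  · rw [← hA0, mul_zero, div_zero, Real.rpow_zero, mul_one]
    exact hmono.trans (le_mul_of_one_le_left hI0 (by linarith [K.toReal_nonneg]))
  -- A measurable set inside the rectangle that agrees with `E` up to a null set.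
  set E' := toMeasurable volume E ∩ Icc a b
  have hEE' : E' =ᵐ[volume] E := by
    have := hE.toMeasurable_ae_eq.inter (ae_eq_refl (Icc a b))
    rwa [inter_eq_left.2 hER] at this
  have key := hmain (1 / (10 * A)) (by positivity) (fun x => ENNReal.ofReal (w x))
    hwm.aemeasurable.ennreal_ofReal
    (ae_hasAinftyEstimate_update hw0 hA0 (ENNReal.ofReal_toReal hw.const_lt_top.ne).ge) a b hab E'
    ((measurableSet_toMeasurable _ _).inter measurableSet_Icc) inter_subset_right
  rw [setLIntegral_congr hEE', measure_congr hEE'] at key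
  have hfin : ∫⁻ x in Icc a b, ENNReal.ofReal (w x) ≠ ∞ := by
    have := hint.lintegral_lt_top
    exact this.ne
  have hratio : volume E / volume (Icc a b) ≤ 1 :=
    ENNReal.div_le_of_le_mul (by rw [one_mul]; exact measure_mono hER)
  have hδ : 0 ≤ 1 / (10 * A) / n := by positivity
  have hκ : K * (volume E / volume (Icc a b)) ^ (1 / (10 * A) / n) ≠ ∞ :=
    ENNReal.mul_ne_top hK ((ENNReal.rpow_le_one hratio hδ).trans_lt ENNReal.one_lt_top).ne
  have key' := ENNReal.toReal_mono (ENNReal.mul_ne_top hκ hfin) key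
  rw [ENNReal.toReal_mul, ENNReal.toReal_mul, ← ENNReal.toReal_rpow, ENNReal.toReal_div,
    ← integral_eq_lintegral_of_nonneg_ae (Filter.Eventually.of_forall hw0) hwm.restrict,
    ← integral_eq_lintegral_of_nonneg_ae (Filter.Eventually.of_forall hw0) hwm.restrict,
    div_div, mul_right_comm (10 : ℝ)] at key'
  refine key'.trans ?_
  refine mul_le_mul_of_nonneg_right (mul_le_mul_of_nonneg_right (by linarith) ?_) hI0
  positivity
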